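/- Let $n\ge 0$ be an integer and equip $\mathbb{R}^n$ with the product order ($x\le y$ if $x_i\le y_i$ for all $i$). A map $f:\mathbb{R}^n\to\mathbb{R}^n$ is called monotone if $x\le y$ implies $f(x)\le f(y)$; (additively) homogeneous if $f(\lambda+x)=\lambda+f(x)$ for all $\lambda\in\mathbb{R}$ and $x\in\mathbb{R}^n$, where $\lambda+x=(\lambda+x_1,\ldots,\lambda+x_n)$; and convex if each of its coordinate functions is convex. A periodic orbit of $f$ is a set $\{f^k(x) : k\in\mathbb{N}\}$ where $x\in\mathbb{R}^n$ satisfies $f^c(x)=x$ for some integer $c\ge 1$; its length is the least such $c$. Then the set of all lengths of periodic orbits of convex monotone homogeneous maps $\mathbb{R}^n\to\mathbb{R}^n$ is exactly the set of orders of elements of the symmetric group on $n$ letters. -/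

import Mathlib

/-- Additive homogeneity of `f : ℝⁿ → ℝⁿ`: `f` commutes with the addition of constants. -/
def AdditivelyHomogeneous {n : ℕ} (f : (Fin n → ℝ) → (Fin n → ℝ)) : Prop :=
  ∀ (a : ℝ) (x : Fin n → ℝ), f (fun i => a + x i) = fun i => a + f x i

/-- Convex monotone (additively) homogeneous self-maps of `ℝⁿ`. The order on `Fin n → ℝ` is the
product order, so convexity means convexity of every coordinate function. -/
structure IsConvexMonotoneHomogeneous {n : ℕ} (f : (Fin n → ℝ) → (Fin n → ℝ)) : Prop where
  convex : ConvexOn ℝ Set.univ f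
  monotone : Monotone f
  homogeneous : AdditivelyHomogeneous f

/-- `c` is the length of a periodic orbit of `f`: some point `x` satisfies `f^k(x) = x` for some
`k ≥ 1`, and `c` is the least such `k`. -/
def IsPeriodicOrbitLength {α : Type*} (f : α → α) (c : ℕ) : Prop :=
  ∃ x ∈ Function.periodicPts f, Function.minimalPeriod f x = c

open Function Set

/-! Permuting coordinates realizes every order. Conversely, along an orbit `x k` (`k` in `ZMod c`),
subgradients are stochastic by monotonicity and homogeneity. They define a Markov chain on pairs
(time, coordinate), running backwards in time, for which every increment `x (k + j) i - x k i` is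
superharmonic. By the minimum principle the increments are constant on each final class, so the
coordinates met there share one period `p`, and those met at times `0, ..., p - 1` are distinct.
Hence at least `p` coordinates have period `p`. Let `L` be the lcm of all periods that are so
abundant. The increment by `L` vanishes on final classes, so it is nonnegative everywhere, and
periodicity makes it zero. Thus `c = L`, and disjoint cycles of these lengths fit into `n` letters.
-/

/-! ### Stochastic subgradients -/

/-- A finite convex function on a finite-dimensional space has a subgradient at every point. -/
theorem ConvexOn.exists_subgradient {E : Type*} [NormedAddCommGroup E] [NormedSpace ℝ E]
    [FiniteDimensional ℝ E] {g : E → ℝ} (hg : ConvexOn ℝ univ g) (x : E) :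
    ∃ l : E →ₗ[ℝ] ℝ, ∀ y, l (y - x) ≤ g y - g x := by
  have hc : Continuous g := hg.locallyLipschitz.continuous
  have hopen : IsOpen {p : E × ℝ | p.1 ∈ univ ∧ g p.1 < p.2} := by
    simpa using isOpen_lt (hc.comp continuous_fst) continuous_snd
  obtain ⟨φ, hφ⟩ := geometric_hahn_banach_point_open hg.convex_strict_epigraph hopen
    (x := (x, g x)) (by simp)
  have split : ∀ y t, φ (y, t) = φ (y, 0) + t * φ (0, 1) := fun y t => by
    rw [← smul_eq_mul, ← map_smul, ← map_add]; simp
  have ha : 0 < φ (0, 1) := by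
    have h := hφ (x, g x + 1) (by simp)
    rw [split x (g x), split x (g x + 1)] at h
    linarith
  refine ⟨-(φ (0, 1))⁻¹ • (φ.toLinearMap ∘ₗ LinearMap.inl ℝ E ℝ), fun y => ?_⟩
  have hle : φ (x, 0) + g x * φ (0, 1) ≤ φ (y, 0) + g y * φ (0, 1) := by
    refine le_of_forall_pos_lt_add fun ε hε => ?_
    have h := hφ (y, g y + ε / φ (0, 1)) (by simp; positivity)
    rw [split x (g x), split y] at h
    have : ε / φ (0, 1) * φ (0, 1) = ε := by field_simp
    linarith
  have hsub : φ (y - x, 0) = φ (y, 0) - φ (x, 0) := by rw [← map_sub]; simp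
  have : -(φ (0, 1))⁻¹ * φ (y - x, 0) ≤ g y - g x := by
    rw [neg_mul, neg_le_iff_add_nonneg, hsub, inv_mul_eq_div]
    rw [← sub_nonneg] at hle
    have := div_nonneg hle ha.le
    have e : (φ (y, 0) + g y * φ (0, 1) - (φ (x, 0) + g x * φ (0, 1))) / φ (0, 1)
        = g y - g x + (φ (y, 0) - φ (x, 0)) / φ (0, 1) := by field_simp; ring
    rwa [e] at this
  simpa using this

/-- At every point a convex monotone homogeneous map has a stochastic subgradient in each
coordinate. -/
theorem IsConvexMonotoneHomogeneous.exists_stochastic_subgradient {n : ℕ}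
    {f : (Fin n → ℝ) → (Fin n → ℝ)} (hf : IsConvexMonotoneHomogeneous f)
    (x : Fin n → ℝ) (i : Fin n) :
    ∃ p : Fin n → ℝ, (∀ j, 0 ≤ p j) ∧ ∑ j, p j = 1 ∧
      ∀ y, ∑ j, p j * (y j - x j) ≤ f y i - f x i := by
  have hg : ConvexOn ℝ univ fun y => f y i :=
    ⟨convex_univ, fun y hy z hz a b ha hb hab => hf.convex.2 hy hz ha hb hab i⟩
  obtain ⟨l, hl⟩ := hg.exists_subgradient x
  have hsum : ∀ v : Fin n → ℝ, l v = ∑ j, l (Pi.single j 1) * v j := fun v => by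
    conv_lhs => rw [← Finset.univ_sum_single v, map_sum]
    refine Finset.sum_congr rfl fun j _ => ?_
    rw [mul_comm, ← smul_eq_mul, ← map_smul, ← Pi.single_smul, smul_eq_mul, mul_one]
  have hconst : ∀ a : ℝ, a * ∑ j, l (Pi.single j 1) ≤ a := fun a => by
    have h := hl (fun j => a + x j)
    rw [hf.homogeneous, hsum] at h
    simp only [Pi.sub_apply, add_sub_cancel_right] at h
    rwa [← Finset.sum_mul, mul_comm] at h
  refine ⟨fun j => l (Pi.single j 1), fun j => ?_, ?_, fun y => ?_⟩
  · have h := hl (x - Pi.single j 1)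
    have hm : f (x - Pi.single j 1) i ≤ f x i :=
      hf.monotone (sub_le_self x (Pi.single_nonneg.2 zero_le_one)) i
    rw [sub_sub_cancel_left, map_neg] at h
    linarith
  -- Translations by `1` and `-1` bound the total mass from above and below.
  · have h₁ := hconst 1
    have h₂ := hconst (-1)
    linarith
  · simpa [hsum (y - x)] using hl y

/-! ### Minimum principle for finite Markov chains -/

section Superharmonic

variable {S : Type*} [Fintype S]

/-- `R` is closed under the transitions of positive weight. -/
def IsClosedClass (Q : S → S → ℝ) (R : Set S) : Prop :=
  ∀ s ∈ R, ∀ t, 0 < Q s t → t ∈ R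

/-- The minimizers of a superharmonic function on a closed class form a closed class. -/
theorem IsClosedClass.minimizers {Q : S → S → ℝ} (h0 : ∀ s t, 0 ≤ Q s t)
    (h1 : ∀ s, ∑ t, Q s t = 1) {R : Set S} (hR : IsClosedClass Q R) {d : S → ℝ}
    (hd : ∀ s, ∑ t, Q s t * d t ≤ d s) {m : ℝ} (hm : ∀ s ∈ R, m ≤ d s) :
    IsClosedClass Q {s ∈ R | d s = m} := by
  rintro s ⟨hs, hsm⟩ t ht
  have htR := hR s hs t ht
  refine ⟨htR, ?_⟩
  have hnn : ∀ u ∈ Finset.univ, 0 ≤ Q s u * (d u - m) := fun u _ => by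
    rcases (h0 s u).eq_or_lt with h | h
    · simp [← h]
    · exact mul_nonneg h.le (sub_nonneg.2 (hm u (hR s hs u h)))
  have hle : ∑ u, Q s u * (d u - m) ≤ 0 := by
    have := hd s
    simp only [mul_sub, Finset.sum_sub_distrib, ← Finset.sum_mul, h1]
    linarith
  have h := (Finset.sum_eq_zero_iff_of_nonneg hnn).1
    (le_antisymm hle (Finset.sum_nonneg hnn)) t (Finset.mem_univ t)
  rcases mul_eq_zero.1 h with h | h <;> linarith

/-- `R` is a minimal nonempty closed class. -/
def IsFinalClass (Q : S → S → ℝ) (R : Set S) : Prop :=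
  Minimal (fun R => R.Nonempty ∧ IsClosedClass Q R) R

/-- The minimizers within `R` form a nonempty closed class, which is all of `R` by minimality. -/
theorem IsFinalClass.superharmonic_const {Q : S → S → ℝ} (h0 : ∀ s t, 0 ≤ Q s t)
    (h1 : ∀ s, ∑ t, Q s t = 1) {R : Set S} (hR : IsFinalClass Q R) {d : S → ℝ}
    (hd : ∀ s, ∑ t, Q s t * d t ≤ d s) : ∃ a, ∀ s ∈ R, d s = a := by
  obtain ⟨s, hs, hmin⟩ := Set.Finite.exists_minimalFor d R R.toFinite hR.prop.1
  have hm : ∀ t ∈ R, d s ≤ d t := fun t ht => (le_total (d s) (d t)).elim id (hmin ht)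
  exact ⟨d s, fun t ht => ((hR.le_of_le (y := {t ∈ R | d t = d s})
    ⟨⟨s, hs, rfl⟩, hR.prop.2.minimizers h0 h1 hd hm⟩ (fun _ h => h.1)) ht).2⟩

/-- A superharmonic function which is nonnegative on the final classes is nonnegative. -/
theorem superharmonic_nonneg {Q : S → S → ℝ} (h0 : ∀ s t, 0 ≤ Q s t)
    (h1 : ∀ s, ∑ t, Q s t = 1) {d : S → ℝ} (hd : ∀ s, ∑ t, Q s t * d t ≤ d s)
    (hnn : ∀ R, IsFinalClass Q R → ∀ s ∈ R, 0 ≤ d s) (s : S) : 0 ≤ d s := by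
  obtain ⟨t, -, ht⟩ := Set.Finite.exists_minimalFor d univ univ.toFinite ⟨s, trivial⟩
  have hm : ∀ u ∈ univ, d t ≤ d u := fun u hu => (le_total (d t) (d u)).elim id (ht hu)
  have hcl : IsClosedClass Q {u ∈ univ | d u = d t} :=
    IsClosedClass.minimizers h0 h1 (fun _ _ _ _ => trivial) hd hm
  obtain ⟨R, hRle, hR⟩ := (toFinite {R : Set S | R.Nonempty ∧ IsClosedClass Q R}).exists_le_minimal
    (a := {u ∈ univ | d u = d t}) ⟨⟨t, trivial, rfl⟩, hcl⟩
  obtain ⟨u, hu⟩ := hR.prop.1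
  exact ((hnn R hR u hu).trans_eq (hRle hu).2).trans (hm s trivial)

end Superharmonic

/-! ### Periods of cyclic sequences -/

section CyclicSequences

variable {c : ℕ}

/-- The least period of a function on `ZMod c` under translation. -/
noncomputable def translationPeriod (s : ZMod c → ℝ) : ℕ :=
  minimalPeriod (fun (g : ZMod c → ℝ) k => g (k + 1)) s

theorem iterate_translation (s : ZMod c → ℝ) (j : ℕ) :
    (fun (g : ZMod c → ℝ) k => g (k + 1))^[j] s = fun k => s (k + j) := by
  induction j with
  | zero => simp
  | succ j ih => rw [iterate_succ_apply', ih]; ext k; push_cast; congr 1; ring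

theorem isPeriodicPt_translation (s : ZMod c → ℝ) (j : ℕ) :
    IsPeriodicPt (fun (g : ZMod c → ℝ) k => g (k + 1)) j s ↔ ∀ k, s (k + j) = s k := by
  rw [IsPeriodicPt, IsFixedPt, iterate_translation, funext_iff]

theorem translationPeriod_dvd_iff (s : ZMod c → ℝ) (j : ℕ) :
    translationPeriod s ∣ j ↔ ∀ k, s (k + j) = s k := by
  rw [← isPeriodicPt_translation]
  exact isPeriodicPt_iff_minimalPeriod_dvd.symm

theorem translationPeriod_dvd (s : ZMod c → ℝ) : translationPeriod s ∣ c := by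
  simp [translationPeriod_dvd_iff]

/-- Sequences on `ZMod c` with the same increments, up to a shift, have the same period. -/
theorem translationPeriod_congr {s t : ZMod c → ℝ} {k l : ZMod c}
    (h : ∀ j, s (k + j) - s k = t (l + j) - t l) :
    translationPeriod s = translationPeriod t := by
  refine Nat.dvd_right_iff_eq.1 fun j => ?_
  rw [translationPeriod_dvd_iff, translationPeriod_dvd_iff]
  constructor <;> intro hj m
  · have h₁ := h (m - l + j)
    have h₂ := h (m - l)
    have h₃ := hj (k + (m - l))
    rw [show l + (m - l + j) = m + j by ring] at h₁
    rw [show l + (m - l) = m by ring] at h₂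
    rw [← add_assoc] at h₁
    linarith
  · have h₁ := h (m - k + j)
    have h₂ := h (m - k)
    have h₃ := hj (l + (m - k))
    rw [show k + (m - k + j) = m + j by ring] at h₁
    rw [show k + (m - k) = m by ring] at h₂
    rw [← add_assoc l] at h₁
    linarith

/-- A shift that preserves the increments of a sequence on `ZMod c` preserves the sequence. -/
theorem translationPeriod_dvd_of_increments [NeZero c] {s : ZMod c → ℝ} {k : ZMod c} {d : ℕ}
    (h : ∀ j, s (k + j) - s k = s (k + d + j) - s (k + d)) : translationPeriod s ∣ d := by
  have hstep : ∀ m, s (m + d) = s m + (s (k + d) - s k) := fun m => by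
    have := h (m - k)
    rw [show k + (m - k) = m by ring, show k + d + (m - k) = m + d by ring] at this
    linarith
  have hiter : ∀ (N : ℕ) m, s (m + N * d) = s m + N * (s (k + d) - s k) := fun N => by
    induction N with
    | zero => simp
    | succ N ih =>
      intro m
      rw [show m + ((N + 1 : ℕ) : ZMod c) * d = m + N * d + d by push_cast; ring, hstep, ih]
      push_cast; ring
  -- After `c` shifts by `d` the sequence is back at its start, so the constant drift is zero.
  have h0 : s (k + d) - s k = 0 := by
    have := hiter c 0
    simpa [NeZero.ne c] using this
  rw [translationPeriod_dvd_iff]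
  intro m
  rw [hstep, h0, add_zero]

end CyclicSequences

/-! ### Permutations with prescribed cycle lengths -/

/-- Distinct positive integers, each attained by a function at least as many times as its value,
have a least common multiple which is the order of a permutation. -/
theorem Equiv.Perm.exists_orderOf_eq_lcm_image {α : Type*} [Fintype α] [DecidableEq α]
    (p : α → ℕ) (hp : ∀ i, p i ≠ 0) (J : Finset α)
    (hJ : ∀ i ∈ J, p i ≤ (Finset.univ.filter fun i' => p i' = p i).card) :
    ∃ σ : Equiv.Perm α, orderOf σ = J.lcm p := by
  -- Cycle types omit fixed points, and the value `1` does not affect the lcm.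
  set A := (J.image p).filter (2 ≤ ·) with hA
  have hsum : A.val.sum ≤ Fintype.card α := by
    calc A.val.sum = ∑ q ∈ A, q := by rw [Finset.sum, Multiset.map_id']
      _ ≤ ∑ q ∈ A, (Finset.univ.filter fun i => p i = q).card := by
          refine Finset.sum_le_sum fun q hq => ?_
          obtain ⟨i, hi, rfl⟩ := Finset.mem_image.1 (Finset.mem_filter.1 hq).1
          exact hJ i hi
      _ = (Finset.univ.filter fun i => p i ∈ A).card := by
          rw [Finset.card_eq_sum_card_fiberwise (s := Finset.univ.filter fun i => p i ∈ A)
            (f := p) (t := A) (fun i hi => by simpa using hi)]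
          refine Finset.sum_congr rfl fun q hq => congrArg _ ?_
          ext i
          simp only [Finset.mem_filter, Finset.mem_univ, true_and]
          exact ⟨fun h => ⟨h ▸ hq, h⟩, fun h => h.2⟩
      _ ≤ Fintype.card α := Finset.card_le_univ _
  obtain ⟨σ, hσ⟩ := (Equiv.Perm.exists_with_cycleType_iff α (m := A.val)).2
    ⟨hsum, fun a ha => (Finset.mem_filter.1 ha).2⟩
  refine ⟨σ, ?_⟩
  rw [← Equiv.Perm.lcm_cycleType, hσ]
  refine Nat.dvd_antisymm (Multiset.lcm_dvd.2 fun q hq => ?_) (Finset.lcm_dvd fun i hi => ?_)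
  · obtain ⟨i, hi, rfl⟩ := Finset.mem_image.1 (Finset.mem_filter.1 hq).1
    exact Finset.dvd_lcm hi
  · by_cases h : 2 ≤ p i
    · exact Multiset.dvd_lcm (Finset.mem_filter.2 ⟨Finset.mem_image_of_mem p hi, h⟩)
    · have := hp i
      rw [show p i = 1 by omega]
      exact one_dvd _

/-! ### The Markov chain along an orbit -/

section CyclicOrbit

variable {n c : ℕ} [NeZero c] {f : (Fin n → ℝ) → (Fin n → ℝ)} {x : ZMod c → Fin n → ℝ}

/-- Along a periodic orbit, time-space Markov transitions exist for which all the increments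
`x (k + j) - x k` are superharmonic. -/
theorem IsConvexMonotoneHomogeneous.exists_transitions (hf : IsConvexMonotoneHomogeneous f)
    (hx : ∀ k, f (x k) = x (k + 1)) :
    ∃ Q : ZMod c × Fin n → ZMod c × Fin n → ℝ, (∀ s t, 0 ≤ Q s t) ∧ (∀ s, ∑ t, Q s t = 1) ∧
      (∀ s t, 0 < Q s t → t.1 + 1 = s.1) ∧
      ∀ j s, ∑ t, Q s t * (x (t.1 + j) t.2 - x t.1 t.2) ≤ x (s.1 + j) s.2 - x s.1 s.2 := by
  choose p hp0 hp1 hp using fun k i => hf.exists_stochastic_subgradient (x k) i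
  have hsum : ∀ (s : ZMod c × Fin n) (d : ZMod c × Fin n → ℝ),
      ∑ t : ZMod c × Fin n, (if t.1 = s.1 - 1 then p t.1 s.2 t.2 else 0) * d t
        = ∑ i, p (s.1 - 1) s.2 i * d (s.1 - 1, i) := fun s d => by
    rw [Fintype.sum_prod_type, Finset.sum_eq_single (s.1 - 1)]
    · simp
    · intro k _ hk; simp [hk]
    · simp
  refine ⟨fun s t => if t.1 = s.1 - 1 then p t.1 s.2 t.2 else 0, fun s t => ?_, fun s => ?_,
    fun s t h => ?_, fun j s => ?_⟩
  · dsimp only; split_ifs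
    exacts [hp0 _ _ _, le_rfl]
  · simpa [hp1] using hsum s fun _ => 1
  · dsimp only at h; split_ifs at h with e
    · rw [e]; ring
    · exact absurd h (lt_irrefl 0)
  · rw [hsum s fun t => x (t.1 + j) t.2 - x t.1 t.2]
    have h := hp (s.1 - 1) s.2 (x (s.1 - 1 + j))
    rw [hx, hx, show s.1 - 1 + j + 1 = s.1 + j by ring, sub_add_cancel] at h
    exact h

/-- A time-space final class meets every time. -/
theorem IsFinalClass.exists_mem_fst {Q : ZMod c × Fin n → ZMod c × Fin n → ℝ}
    (h1 : ∀ s, ∑ t, Q s t = 1) (hlev : ∀ s t, 0 < Q s t → t.1 + 1 = s.1)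
    {R : Set (ZMod c × Fin n)} (hR : IsFinalClass Q R) (k : ZMod c) : ∃ i, (k, i) ∈ R := by
  obtain ⟨⟨l, i₀⟩, hs⟩ := hR.prop.1
  have hdown : ∀ N : ℕ, ∃ i, (l - N, i) ∈ R := fun N => by
    induction N with
    | zero => exact ⟨i₀, by simpa using hs⟩
    | succ N ih =>
      obtain ⟨i, hi⟩ := ih
      obtain ⟨⟨m, i'⟩, -, ht⟩ := Finset.exists_lt_of_sum_lt
        (s := Finset.univ) (f := fun _ => (0 : ℝ)) (g := Q (l - N, i)) (by simp [h1])
      have hm : m = l - (N + 1 : ℕ) := by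
        have := hlev _ _ ht
        push_cast
        linear_combination this
      exact ⟨i', hm ▸ hR.prop.2 _ hi _ ht⟩
  obtain ⟨i, hi⟩ := hdown (l - k).val
  exact ⟨i, by simpa using hi⟩

/-- A cyclic orbit is invariant under every shift that is a multiple of the periods of those
coordinates whose period is shared by at least as many coordinates. -/
theorem IsConvexMonotoneHomogeneous.shift_invariant (hf : IsConvexMonotoneHomogeneous f)
    (hx : ∀ k, f (x k) = x (k + 1)) {L : ℕ}
    (hL : ∀ i, translationPeriod (x · i) ≤ (Finset.univ.filter fun i' =>
      translationPeriod (x · i') = translationPeriod (x · i)).card →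
        translationPeriod (x · i) ∣ L) (k : ZMod c) :
    x (k + L) = x k := by
  obtain ⟨Q, h0, h1, hlev, hsup⟩ := hf.exists_transitions hx
  have hfinal : ∀ R, IsFinalClass Q R → ∀ s ∈ R, translationPeriod (x · s.2) ∣ L := by
    intro R hR s hs
    refine hL _ ?_
    have hinc : ∀ u ∈ R, ∀ v ∈ R, ∀ j,
        x (u.1 + j) u.2 - x u.1 u.2 = x (v.1 + j) v.2 - x v.1 v.2 := fun u hu v hv j => by
      obtain ⟨a, ha⟩ := hR.superharmonic_const h0 h1 (hsup j)
      rw [ha u hu, ha v hv]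
    choose φ hφ using hR.exists_mem_fst h1 hlev
    have hper : ∀ k, translationPeriod (x · (φ k)) = translationPeriod (x · s.2) := fun k =>
      translationPeriod_congr (hinc _ (hφ k) s hs)
    -- If one coordinate is chosen at times `a` and `a + d`, equal increments make `d` a multiple of
    -- the period.
    have hinj : ∀ a b : ℕ, a ≤ b → b < translationPeriod (x · s.2) → φ a = φ b → a = b := by
      intro a b hab hb he
      obtain ⟨d, rfl⟩ := Nat.exists_eq_add_of_le hab
      have hd : translationPeriod (x · (φ a)) ∣ d := by
        refine translationPeriod_dvd_of_increments (k := a) fun j => ?_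
        have := hinc _ (hφ a) _ (hφ (a + d : ℕ)) j
        rw [← he] at this
        simpa using this
      rw [hper] at hd
      have := Nat.eq_zero_of_dvd_of_lt hd (by omega)
      omega
    calc translationPeriod (x · s.2)
        = (Finset.range (translationPeriod (x · s.2))).card := (Finset.card_range _).symm
      _ ≤ _ := Finset.card_le_card_of_injOn (fun a : ℕ => φ a) (fun a _ => by simp [hper]) ?_
    intro a ha b hb he
    rw [Finset.coe_range, mem_Iio] at ha hb
    rcases le_total a b with h | h
    · exact hinj a b h hb he
    · exact (hinj b a h ha he.symm).symm
  have hle : ∀ k, x k ≤ x (k + L) := fun k i => by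
    have := superharmonic_nonneg h0 h1 (hsup L) (fun R hR s hs => by
      rw [(translationPeriod_dvd_iff _ _).1 (hfinal R hR s hs), sub_self]) (k, i)
    simpa using this
  have hiter : ∀ (N : ℕ) k, x k ≤ x (k + N * L) := fun N => by
    induction N with
    | zero => simp
    | succ N ih =>
      intro k
      refine (ih k).trans ((hle _).trans_eq (congrArg x ?_))
      push_cast; ring
  refine le_antisymm ?_ (hle k)
  -- A further `c - 1` shifts by `L` lead from `k + L` back to `k`, closing the chain of
  -- inequalities.
  obtain ⟨N, hN⟩ : ∃ N, c = N + 1 := Nat.exists_eq_succ_of_ne_zero (NeZero.ne c)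
  refine (hiter N (k + L)).trans_eq (congrArg x ?_)
  have : (N : ZMod c) + 1 = 0 := by
    rw [← Nat.cast_succ, Nat.succ_eq_add_one, ← hN, ZMod.natCast_self]
  linear_combination (L : ZMod c) * this

end CyclicOrbit

theorem IsConvexMonotoneHomogeneous.exists_orderOf_eq_minimalPeriod {n : ℕ}
    {f : (Fin n → ℝ) → (Fin n → ℝ)} (hf : IsConvexMonotoneHomogeneous f)
    {x₀ : Fin n → ℝ} (hx₀ : x₀ ∈ periodicPts f) :
    ∃ σ : Equiv.Perm (Fin n), orderOf σ = minimalPeriod f x₀ := by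
  obtain ⟨c, hc⟩ : ∃ c, minimalPeriod f x₀ = c := ⟨_, rfl⟩
  have : NeZero c := ⟨by rw [← hc]; exact (minimalPeriod_pos_of_mem_periodicPts hx₀).ne'⟩
  set x : ZMod c → Fin n → ℝ := fun k => f^[k.val] x₀ with hxdef
  have hxcast : ∀ m : ℕ, x m = f^[m] x₀ := fun m => by
    simp only [hxdef, ZMod.val_natCast]
    rw [← hc, iterate_mod_minimalPeriod_eq]
  have hx : ∀ k, f (x k) = x (k + 1) := fun k => by
    have h := hxcast (k.val + 1)
    rw [iterate_succ_apply'] at h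
    simpa using h.symm
  classical
  set J := Finset.univ.filter fun i => translationPeriod (x · i) ≤ (Finset.univ.filter fun i' =>
      translationPeriod (x · i') = translationPeriod (x · i)).card with hJ
  obtain ⟨σ, hσ⟩ := Equiv.Perm.exists_orderOf_eq_lcm_image (fun i => translationPeriod (x · i))
    (fun i => ne_zero_of_dvd_ne_zero (NeZero.ne c) (translationPeriod_dvd _)) J
    (fun i hi => (Finset.mem_filter.1 hi).2)
  refine ⟨σ, ?_⟩
  rw [hσ]
  refine Nat.dvd_antisymm (Finset.lcm_dvd fun i _ => (translationPeriod_dvd _).trans hc.symm.dvd) ?_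
  refine IsPeriodicPt.minimalPeriod_dvd ?_
  have h := hf.shift_invariant hx (L := J.lcm fun i => translationPeriod (x · i))
    (fun i hi => Finset.dvd_lcm (Finset.mem_filter.2 ⟨Finset.mem_univ i, hi⟩)) 0
  rw [zero_add, hxcast] at h
  exact h.trans (by simp [hxdef])

/-! ### Realization by permutations, and the conclusion -/

theorem isConvexMonotoneHomogeneous_comp_perm {n : ℕ} (σ : Equiv.Perm (Fin n)) :
    IsConvexMonotoneHomogeneous fun x : Fin n → ℝ => x ∘ σ where
  convex := ⟨convex_univ, fun _ _ _ _ _ _ _ _ _ => le_rfl⟩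
  monotone _ _ h i := h (σ i)
  homogeneous _ _ := rfl

theorem isPeriodicOrbitLength_comp_perm {n : ℕ} (σ : Equiv.Perm (Fin n)) :
    IsPeriodicOrbitLength (fun x : Fin n → ℝ => x ∘ σ) (orderOf σ) := by
  have hiter : ∀ (k : ℕ) (x : Fin n → ℝ), (fun x : Fin n → ℝ => x ∘ σ)^[k] x = x ∘ (σ ^ k) := by
    intro k
    induction k with
    | zero => intro x; rfl
    | succ k ih => intro x; rw [iterate_succ_apply, ih, pow_succ']; rfl
  -- A point with distinct coordinates is fixed only by the identity.
  have hper : ∀ k, IsPeriodicPt (fun x : Fin n → ℝ => x ∘ σ) k (fun i => (i : ℕ)) ↔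
      σ ^ k = 1 := fun k => by
    rw [IsPeriodicPt, IsFixedPt, hiter, funext_iff, Equiv.ext_iff]
    simp [Fin.ext_iff]
  refine ⟨fun i => (i : ℕ), ⟨orderOf σ, orderOf_pos σ, (hper _).2 (pow_orderOf_eq_one σ)⟩, ?_⟩
  refine Nat.dvd_right_iff_eq.1 fun k => ?_
  rw [← isPeriodicPt_iff_minimalPeriod_dvd, hper, orderOf_dvd_iff_pow_eq_one]

theorem mainTheorem3 (n : ℕ) :
    {c : ℕ | ∃ f : (Fin n → ℝ) → (Fin n → ℝ),
      IsConvexMonotoneHomogeneous f ∧ IsPeriodicOrbitLength f c} =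
    {c : ℕ | ∃ σ : Equiv.Perm (Fin n), orderOf σ = c} := by
  ext c
  constructor
  · rintro ⟨f, hf, x, hx, rfl⟩
    exact hf.exists_orderOf_eq_minimalPeriod hx
  · rintro ⟨σ, rfl⟩
    exact ⟨_, isConvexMonotoneHomogeneous_comp_perm σ, isPeriodicOrbitLength_comp_perm σ⟩
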